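/- All paths are simple. For paths $P,Q$ in a graph $H$, write $P\sim Q$ if they have a common edge and no vertex has degree at least $3$ in $P\cup Q$. For a family $\mathcal P=(P_v)_{v\in V}$ of paths in $H$, the graph $\mathrm{ENP}(\mathcal P)$ has vertex set $V$, with $u\neq v$ adjacent if and only if $P_u\sim P_v$. A bend of a path in a (finite, two-dimensional) grid is an internal vertex of the path at which one of the two incident path edges is horizontal and the other is vertical. A $B_k$-ENPG representation of a graph $G$ is a family of paths in some $m\times n$ grid, each with at most $k$ bends, whose graph $\mathrm{ENP}(\mathcal P)$ is $G$; and $G$ is a $B_k$-ENPG graph if it has such a representation. **Proposition.** Let $G$ be a co-bipartite graph whose vertex set is partitioned into two cliques $K,K'$, and let $E$ be the set of edges of $G$ between $K$ and $K'$. Suppose that the bipartite graph $G_B=(K\cup K',E)$ is isomorphic to $3K_2$ (three pairwise disjoint edges). Then $G$ is a $B_1$-ENPG graph, and every $B_1$-ENPG representation of $G$ contains at least one path with zero bends. Consequently, $B_k$-ENPG graphs do not in general admit a representation in which every path has exactly $k$ bends: already for $k=1$, there is a finite $B_1$-ENPG graph that has no ENPG representation in which every path has exactly one bend. -/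

import Mathlib

open SimpleGraph

/-- A (simple) path in the graph `H`: a walk without repeated vertices, with its endpoints. -/
structure GPath {W : Type*} (H : SimpleGraph W) where
  src : W
  tgt : W
  walk : H.Walk src tgt
  isPath : walk.IsPath

namespace GPath

variable {W : Type*} {H : SimpleGraph W}

/-- The union `P ∪ Q` of two paths, as a subgraph of the host graph. -/
def union (P Q : GPath H) : H.Subgraph := P.walk.toSubgraph ⊔ Q.walk.toSubgraph

/-- `P` and `Q` have a common edge. -/
def EdgeIntersect (P Q : GPath H) : Prop := ∃ e, e ∈ P.walk.edges ∧ e ∈ Q.walk.edges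

/-- A split of `P`, `Q` is a vertex of degree at least `3` in `P ∪ Q`. -/
def splits (P Q : GPath H) : Set W := {w | 3 ≤ ((P.union Q).neighborSet w).encard}

/-- `P ∼ Q`: the paths edge-intersect and have no split. -/
def NonSplitting (P Q : GPath H) : Prop := P.EdgeIntersect Q ∧ P.splits Q = ∅

theorem NonSplitting.symm {P Q : GPath H} (h : P.NonSplitting Q) : Q.NonSplitting P := by
  obtain ⟨⟨e, h1, h2⟩, h3⟩ := h
  refine ⟨⟨e, h2, h1⟩, ?_⟩
  have hu : Q.union P = P.union Q := sup_comm _ _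
  simpa only [splits, hu] using h3

end GPath

/-- The graph of edge-intersecting and non-splitting paths of a family of paths in `H`:
one vertex for each member of the family, and `u`, `v` adjacent iff `P u ∼ P v`. -/
def enpGraph {V W : Type*} {H : SimpleGraph W} (P : V → GPath H) : SimpleGraph V where
  Adj u v := u ≠ v ∧ (P u).NonSplitting (P v)
  symm := ⟨fun _ _ h => ⟨h.1.symm, h.2.symm⟩⟩
  loopless := ⟨fun _ h => h.1 rfl⟩

/-- The `m × n` grid graph: the Cartesian product of two paths on `m` and `n` vertices. -/
abbrev gridGraph (m n : ℕ) : SimpleGraph (Fin m × Fin n) := pathGraph m □ pathGraph n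

namespace GPath

/-- The bends of a path in a grid: the internal vertices at which
one incident edge of the path is horizontal (it keeps the second coordinate)
and one is vertical (it keeps the first coordinate). -/
def bends {m n : ℕ} (P : GPath (gridGraph m n)) : Set (Fin m × Fin n) :=
  {w | w ∈ P.walk.support ∧ w ≠ P.src ∧ w ≠ P.tgt ∧
    (∃ a, s(w, a) ∈ P.walk.edges ∧ a.2 = w.2) ∧ (∃ b, s(w, b) ∈ P.walk.edges ∧ b.1 = w.1)}

/-- The number of bends. -/
noncomputable def numBends {m n : ℕ} (P : GPath (gridGraph m n)) : ℕ := P.bends.ncard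

end GPath

/-- The family `P` of grid paths is a `B_k`-ENPG representation of `G`. -/
def IsBendENPGRep (k : ℕ) {V : Type*} (G : SimpleGraph V) {m n : ℕ}
    (P : V → GPath (gridGraph m n)) : Prop :=
  enpGraph P = G ∧ ∀ v, (P v).numBends ≤ k

/-- `G` is a `B_k`-ENPG graph. -/
def IsBendENPG (k : ℕ) {V : Type*} (G : SimpleGraph V) : Prop :=
  ∃ (m n : ℕ) (P : V → GPath (gridGraph m n)), IsBendENPGRep k G P

/-- `G = C(K, K', E)` is co-bipartite: `K`, `K'` are cliques that partition the vertex set. -/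
def IsCobipartition {V : Type*} (G : SimpleGraph V) (K K' : Set V) : Prop :=
  Disjoint K K' ∧ K ∪ K' = Set.univ ∧ G.IsClique K ∧ G.IsClique K'

/-- `3K₂`: three pairwise disjoint edges. -/
def threeK2 : SimpleGraph (Fin 3 × Fin 2) where
  Adj p q := p.1 = q.1 ∧ p.2 ≠ q.2
  symm := ⟨fun _ _ h => ⟨h.1.symm, h.2.symm⟩⟩
  loopless := ⟨fun _ h => h.2 rfl⟩

/-! Two cliques joined by a perfect matching of size three form the triangular prism, so everything
reduces to this one graph. An explicit family shows that it is `B_1`-ENPG. If no path of a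
representation were straight, every path would be an L-shape, and the contradiction is
combinatorial.

Two L-shapes are adjacent exactly when they have the same bend and quadrant (`Same`), or when
collinear arms face each other and overlap without passing the other bend
(`compat_of_edgeNonSplitting`, `edgeNonSplitting_of_compat`). Facing cannot hold pairwise among
three L-shapes, so each triangle of the prism contains a `Same` pair. Two pairs of indices out of
three intersect. If they coincide, two corners would induce a `2K₂`, but overlap of facing arms
compares endpoints on a line and so gives nested neighbourhoods (`not_matching`). If they share one
index, a triangle formed up to `Same` (`Compat.same_of_triangle`) forces either a forbidden edge or
the previous case. -/

/-! ### Straight segments and L-shapes -/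

/-- `{i, j}` is a unit subinterval of the interval with endpoints `x` and `h`. -/
def UnitIn (x h i j : ℕ) : Prop :=
  (i + 1 = j ∧ (x ≤ i ∧ j ≤ h ∨ h ≤ i ∧ j ≤ x)) ∨ (j + 1 = i ∧ (x ≤ j ∧ i ≤ h ∨ h ≤ j ∧ i ≤ x))

theorem gridGraph_adj_iff {m n : ℕ} {a b : Fin m × Fin n} :
    (gridGraph m n).Adj a b ↔
      (a.2 = b.2 ∧ (a.1.val + 1 = b.1.val ∨ b.1.val + 1 = a.1.val)) ∨
      (a.1 = b.1 ∧ (a.2.val + 1 = b.2.val ∨ b.2.val + 1 = a.2.val)) := by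
  simp only [gridGraph, boxProd_adj, pathGraph_adj]
  tauto

/-- A path in a grid without internal bends is a straight segment. -/
theorem straight_of_no_bend {m n : ℕ} {u v : Fin m × Fin n} (p : (gridGraph m n).Walk u v)
    (hp : p.IsPath)
    (hb : ∀ w ∈ p.support, w ≠ u → w ≠ v → (∃ a, s(w, a) ∈ p.edges ∧ a.2 = w.2) →
      (∃ b, s(w, b) ∈ p.edges ∧ b.1 = w.1) → False) :
    (u.2 = v.2 ∧ ∀ a b, s(a, b) ∈ p.edges ↔
      a.2 = u.2 ∧ b.2 = u.2 ∧ UnitIn u.1 v.1 a.1 b.1) ∨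
    (u.1 = v.1 ∧ ∀ a b, s(a, b) ∈ p.edges ↔
      a.1 = u.1 ∧ b.1 = u.1 ∧ UnitIn u.2 v.2 a.2 b.2) := by
  induction p with
  | nil =>
    left
    refine ⟨rfl, fun a b => ?_⟩
    simp only [Walk.edges_nil, List.not_mem_nil, false_iff, UnitIn]
    omega
  | @cons u u' v h p ih =>
    rw [Walk.cons_isPath_iff] at hp
    obtain ⟨hp, hu⟩ := hp
    have hadj := gridGraph_adj_iff.1 h
    have ih := ih hp (by
      intro w hw hwu hwv ⟨a, ha, ha'⟩ ⟨b, hb', hb''⟩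
      refine hb w (by simp [hw]) (fun hwu' => hu (hwu' ▸ hw)) hwv
        ⟨a, by simp [ha], ha'⟩ ⟨b, by simp [hb'], hb''⟩)
    -- The only possible new bend is `u'`, where the first edge meets the straight tail.
    have hb' : u' ≠ v → (∃ a, s(u', a) ∈ (Walk.cons h p).edges ∧ a.2 = u'.2) →
      (∃ b, s(u', b) ∈ (Walk.cons h p).edges ∧ b.1 = u'.1) → False := fun h1 =>
        hb u' (by simp) (fun h2 => hu (h2 ▸ p.start_mem_support)) h1
    have hu' : s(u', u) ∉ p.edges := fun h => hu (p.snd_mem_support_of_mem_edges h)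
    clear hb hu
    simp only [Walk.edges_cons, List.mem_cons, Sym2.eq_iff] at hb' ⊢
    obtain ⟨u1, u2⟩ := u
    obtain ⟨u1', u2'⟩ := u'
    obtain ⟨v1, v2⟩ := v
    by_cases huv : (u1', u2') = (v1, v2)
    · obtain ⟨rfl, rfl⟩ := Prod.mk.inj huv
      have hnil : ∀ a b, s(a, b) ∉ p.edges := by
        intro a b hab
        rcases ih with ⟨-, ih⟩ | ⟨-, ih⟩ <;>
        · have := (ih a b).1 hab
          simp only [UnitIn] at this
          omega
      clear ih hb' hu'
      rcases hadj with ⟨e, hadj⟩ | ⟨e, hadj⟩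
      · left
        refine ⟨e, fun ⟨a1, a2⟩ ⟨b1, b2⟩ => ?_⟩
        simp only [hnil, or_false, UnitIn, Prod.mk.injEq, Fin.ext_iff] at e hadj ⊢
        omega
      · right
        refine ⟨e, fun ⟨a1, a2⟩ ⟨b1, b2⟩ => ?_⟩
        simp only [hnil, or_false, UnitIn, Prod.mk.injEq, Fin.ext_iff] at e hadj ⊢
        omega
    · have hb' := hb' huv
      rcases ih with ⟨e, ih⟩ | ⟨e, ih⟩
      · left
        have hne : u1'.val ≠ v1.val := fun h => huv (Prod.ext (Fin.ext h) e)
        -- `c` is the next vertex after `u'` on the tail. If the first edge is perpendicular to the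
        -- tail, it witnesses a bend at `u'`; otherwise `hu'` keeps the path from turning back on
        -- itself.
        obtain ⟨c, hc⟩ : ∃ c : Fin m, UnitIn u1' v1 u1' c := by
          rcases lt_or_gt_of_ne hne with h | h
          · exact ⟨⟨u1' + 1, by omega⟩, by dsimp only [UnitIn]; omega⟩
          · exact ⟨⟨u1' - 1, by omega⟩, by dsimp only [UnitIn]; omega⟩
        rcases hadj with ⟨e', hadj⟩ | ⟨e', hadj⟩
        · clear hb'
          simp only [ih] at hu' ⊢
          refine ⟨e'.trans e, fun ⟨a1, a2⟩ ⟨b1, b2⟩ => ?_⟩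
          simp only [UnitIn, Prod.mk.injEq, Fin.ext_iff] at e e' hadj hu' hc ⊢
          simp only [true_and] at hu'
          omega
        · exact (hb' ⟨(c, u2'), Or.inr ((ih _ _).2 ⟨rfl, rfl, hc⟩), rfl⟩
            ⟨(u1, u2), Or.inl (Or.inr ⟨trivial, rfl⟩), e'⟩).elim
      · right
        have hne : u2'.val ≠ v2.val := fun h => huv (Prod.ext e (Fin.ext h))
        obtain ⟨c, hc⟩ : ∃ c : Fin n, UnitIn u2' v2 u2' c := by
          rcases lt_or_gt_of_ne hne with h | h
          · exact ⟨⟨u2' + 1, by omega⟩, by dsimp only [UnitIn]; omega⟩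
          · exact ⟨⟨u2' - 1, by omega⟩, by dsimp only [UnitIn]; omega⟩
        rcases hadj with ⟨e', hadj⟩ | ⟨e', hadj⟩
        · exact (hb' ⟨(u1, u2), Or.inl (Or.inr ⟨trivial, rfl⟩), e'⟩
            ⟨(u1', c), Or.inr ((ih _ _).2 ⟨rfl, rfl, hc⟩), rfl⟩).elim
        · clear hb'
          simp only [ih] at hu' ⊢
          refine ⟨e'.trans e, fun ⟨a1, a2⟩ ⟨b1, b2⟩ => ?_⟩
          simp only [UnitIn, Prod.mk.injEq, Fin.ext_iff] at e e' hadj hu' hc ⊢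
          simp only [true_and] at hu'
          omega

/-- The `L`-shape with bend `(x, y)`, horizontal arm ending at `(h, y)`
and vertical arm ending at `(x, k)`. -/
structure LShape where
  x : ℕ
  y : ℕ
  h : ℕ
  k : ℕ
  hx : h ≠ x
  ky : k ≠ y

namespace LShape

/-- The unit edges of an `L`-shape. -/
def Edge (p : LShape) (a b : ℕ × ℕ) : Prop :=
  (a.2 = p.y ∧ b.2 = p.y ∧ UnitIn p.x p.h a.1 b.1) ∨
  (a.1 = p.x ∧ b.1 = p.x ∧ UnitIn p.y p.k a.2 b.2)

end LShape

/-- The edges of a grid path, in natural number coordinates. -/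
def GPath.NatEdge {m n : ℕ} (P : GPath (gridGraph m n)) (a b : ℕ × ℕ) : Prop :=
  ∃ u v : Fin m × Fin n, s(u, v) ∈ P.walk.edges ∧
    ((u.1 : ℕ), (u.2 : ℕ)) = a ∧ ((v.1 : ℕ), (v.2 : ℕ)) = b

theorem GPath.exists_lShape {m n : ℕ} (P : GPath (gridGraph m n)) (h : P.numBends = 1) :
    ∃ p : LShape, ∀ a b, P.NatEdge a b ↔ p.Edge a b := by
  obtain ⟨w, hw⟩ := Set.ncard_eq_one.1 h
  have hmem : w ∈ P.bends := hw ▸ rfl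
  obtain ⟨hsupp, hws, hwt, ⟨a, ha, haw⟩, ⟨b, hb, hbw⟩⟩ := hmem
  have huniq : ∀ w', w' ∈ P.bends → w' = w := fun w' h => by rw [hw] at h; exact h
  obtain ⟨u, v, p, hp⟩ := P
  simp only [GPath.bends, GPath.NatEdge, Set.mem_ofPred_eq] at *
  obtain ⟨q, r, rfl⟩ := Walk.mem_support_iff_exists_append.1 hsupp
  -- The halves meet only at the bend, so an internal vertex of one half is not an endpoint of the
  -- whole path and a bend there would be a second bend.
  have hdisj : ∀ z, z ∈ q.support → z ∈ r.support → z = w := by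
    intro z h1 h2
    by_contra hz
    have := hp.support_nodup
    rw [Walk.support_append] at this
    refine List.disjoint_of_nodup_append this h1 ?_
    rw [Walk.mem_support_iff] at h2
    tauto
  have hq := straight_of_no_bend q.reverse (hp.of_append_left).reverse (by
    intro z hz h1 h2 ⟨c, hc, hc'⟩ ⟨d, hd, hd'⟩
    simp only [Walk.support_reverse, Walk.edges_reverse, List.mem_reverse] at hz hc hd
    refine h1 (huniq z ⟨by simp [hz], h2, ?_, ⟨c, by simp [hc], hc'⟩, ⟨d, by simp [hd], hd'⟩⟩)
    rintro rfl
    exact h1 (hdisj _ hz r.end_mem_support))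
  have hr := straight_of_no_bend r (hp.of_append_right) (by
    intro z hz h1 h2 ⟨c, hc, hc'⟩ ⟨d, hd, hd'⟩
    refine h1 (huniq z ⟨by simp [hz], ?_, h2, ⟨c, by simp [hc], hc'⟩, ⟨d, by simp [hd], hd'⟩⟩)
    rintro rfl
    exact h1 (hdisj _ q.start_mem_support hz))
  simp only [Walk.edges_reverse, List.mem_reverse] at hq
  simp only [Walk.edges_append, List.mem_append] at ha hb ⊢
  have hwa : ¬(a.1 = w.1) := by
    intro h'
    have : a = w := Prod.ext h' haw
    subst this
    rcases ha with ha | ha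
    · exact (Walk.adj_of_mem_edges _ ha).ne rfl
    · exact (Walk.adj_of_mem_edges _ ha).ne rfl
  have hwb : ¬(b.2 = w.2) := by
    intro h'
    have : b = w := Prod.ext hbw h'
    subst this
    rcases hb with hb | hb
    · exact (Walk.adj_of_mem_edges _ hb).ne rfl
    · exact (Walk.adj_of_mem_edges _ hb).ne rfl
  -- Both halves are straight from `w`. Parallel halves would miss either the vertical edge `wb` or
  -- the horizontal edge `wa`.
  rcases hq with ⟨e1, hq⟩ | ⟨e1, hq⟩ <;> rcases hr with ⟨e2, hr⟩ | ⟨e2, hr⟩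
  · rw [hq, hr] at hb
    tauto
  · refine ⟨⟨w.1, w.2, u.1, v.2, fun h => hws (Prod.ext (Fin.ext h.symm) e1),
      fun h => hwt (Prod.ext e2 (Fin.ext h.symm))⟩, ?_⟩
    intro c d
    simp only [hq, hr, LShape.Edge, UnitIn]
    constructor
    · rintro ⟨c, d, h, rfl, rfl⟩
      simp only [Fin.ext_iff] at *
      omega
    · rintro (h | h)
      · refine ⟨(⟨c.1, by omega⟩, ⟨c.2, by omega⟩), (⟨d.1, by omega⟩, ⟨d.2, by omega⟩), ?_⟩
        simp only [Fin.ext_iff]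
        grind
      · refine ⟨(⟨c.1, by omega⟩, ⟨c.2, by omega⟩), (⟨d.1, by omega⟩, ⟨d.2, by omega⟩), ?_⟩
        simp only [Fin.ext_iff]
        grind
  · refine ⟨⟨w.1, w.2, v.1, u.2, fun h => hwt (Prod.ext (Fin.ext h.symm) e2),
      fun h => hws (Prod.ext e1 (Fin.ext h.symm))⟩, ?_⟩
    intro c d
    simp only [hq, hr, LShape.Edge, UnitIn]
    constructor
    · rintro ⟨c, d, h, rfl, rfl⟩
      simp only [Fin.ext_iff] at *
      omega
    · rintro (h | h)
      · refine ⟨(⟨c.1, by omega⟩, ⟨c.2, by omega⟩), (⟨d.1, by omega⟩, ⟨d.2, by omega⟩), ?_⟩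
        simp only [Fin.ext_iff]
        grind
      · refine ⟨(⟨c.1, by omega⟩, ⟨c.2, by omega⟩), (⟨d.1, by omega⟩, ⟨d.2, by omega⟩), ?_⟩
        simp only [Fin.ext_iff]
        grind
  · rw [hq, hr] at ha
    tauto

/-! ### Non-splitting of L-shapes -/

/-- Edge relations on the integer grid that share an edge and whose union has no vertex with
three distinct neighbours. -/
def EdgeNonSplitting (E F : ℕ × ℕ → ℕ × ℕ → Prop) : Prop :=
  (∃ a b, E a b ∧ F a b) ∧ ∀ w a b c, (E w a ∨ F w a) → (E w b ∨ F w b) → (E w c ∨ F w c) →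
    a ≠ b → a ≠ c → b ≠ c → False

theorem EdgeNonSplitting.symm {E F : ℕ × ℕ → ℕ × ℕ → Prop} (h : EdgeNonSplitting E F) :
    EdgeNonSplitting F E := by
  obtain ⟨⟨a, b, h1, h2⟩, h⟩ := h
  exact ⟨⟨a, b, h2, h1⟩, fun w a b c ha hb hc => h w a b c ha.symm hb.symm hc.symm⟩

theorem three_le_encard_iff {α : Type*} {s : Set α} :
    3 ≤ s.encard ↔ ∃ a b c, a ∈ s ∧ b ∈ s ∧ c ∈ s ∧ a ≠ b ∧ a ≠ c ∧ b ≠ c := by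
  constructor
  · intro h
    obtain ⟨t, hts, ht⟩ := Set.exists_subset_encard_eq h
    obtain ⟨a, b, c, hab, hac, hbc, rfl⟩ := Set.encard_eq_three.1 ht
    exact ⟨a, b, c, hts (by simp), hts (by simp), hts (by simp), hab, hac, hbc⟩
  · rintro ⟨a, b, c, ha, hb, hc, hab, hac, hbc⟩
    rw [← Set.encard_eq_three.2 ⟨a, b, c, hab, hac, hbc, rfl⟩]
    refine Set.encard_le_encard ?_
    rintro x (rfl | rfl | rfl) <;> assumption

namespace LShape

/-- Same bend and same quadrant. -/
def Same (p q : LShape) : Prop :=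
  p.x = q.x ∧ p.y = q.y ∧ (p.x < p.h ↔ q.x < q.h) ∧ (p.y < p.k ↔ q.y < q.k)

/-- The horizontal arms of `p` (on the left) and `q` face each other and overlap,
and neither reaches beyond the bend of the other. -/
def MeetH (p q : LShape) : Prop :=
  p.y = q.y ∧ p.h ≤ q.x ∧ p.x ≤ q.h ∧ q.h < p.h

/-- The vertical arms of `p` (below) and `q` face each other and overlap,
and neither reaches beyond the bend of the other. -/
def MeetV (p q : LShape) : Prop :=
  p.x = q.x ∧ p.k ≤ q.y ∧ p.y ≤ q.k ∧ q.k < p.k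

/-- The combinatorial condition for two `L`-shapes to edge-intersect without a split. -/
def Compat (p q : LShape) : Prop :=
  Same p q ∨ MeetH p q ∨ MeetH q p ∨ MeetV p q ∨ MeetV q p

theorem Same.symm {p q : LShape} (h : p.Same q) : q.Same p := by
  simp only [Same] at *
  tauto

theorem Same.trans {p q r : LShape} (h : p.Same q) (h' : q.Same r) : p.Same r := by
  simp only [Same] at *
  omega

theorem Same.compat {p q : LShape} (h : p.Same q) : p.Compat q := Or.inl h

theorem Compat.symm {p q : LShape} (h : p.Compat q) : q.Compat p := by
  rcases h with h | h | h | h | h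
  · exact h.symm.compat
  · exact Or.inr (Or.inr (Or.inl h))
  · exact Or.inr (Or.inl h)
  · exact Or.inr (Or.inr (Or.inr (Or.inr h)))
  · exact Or.inr (Or.inr (Or.inr (Or.inl h)))

/-- Reflection in the diagonal. -/
def swap (p : LShape) : LShape := ⟨p.y, p.x, p.k, p.h, p.ky, p.hx⟩

theorem swap_edge {p : LShape} {a b : ℕ × ℕ} : p.swap.Edge a b ↔ p.Edge a.swap b.swap := by
  simp only [Edge, swap, Prod.fst_swap, Prod.snd_swap]
  tauto

theorem edgeNonSplitting_swap {p q : LShape} (h : EdgeNonSplitting p.Edge q.Edge) :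
    EdgeNonSplitting p.swap.Edge q.swap.Edge := by
  obtain ⟨⟨a, b, h1, h2⟩, h⟩ := h
  refine ⟨⟨a.swap, b.swap, by simpa [swap_edge] using h1, by simpa [swap_edge] using h2⟩, ?_⟩
  simp only [swap_edge]
  intro w a b c ha hb hc hab hac hbc
  exact h _ _ _ _ ha hb hc (by simpa using hab) (by simpa using hac) (by simpa using hbc)

theorem Same.swap {p q : LShape} (h : p.Same q) : p.swap.Same q.swap :=
  ⟨h.2.1, h.1, h.2.2.2, h.2.2.1⟩

theorem compat_swap {p q : LShape} (h : p.Compat q) : p.swap.Compat q.swap := by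
  rcases h with h | h | h | h | h
  · exact h.swap.compat
  · exact Or.inr (Or.inr (Or.inr (Or.inl h)))
  · exact Or.inr (Or.inr (Or.inr (Or.inr h)))
  · exact Or.inr (Or.inl h)
  · exact Or.inr (Or.inr (Or.inl h))

/-- At a bend the only directions are those of its two arms. Elsewhere the union is locally
horizontal or vertical, since the two bends lie on one row. The truncated `i - 1` and `j - 1` are
harmless: no edge goes below coordinate `0`. -/
theorem exists_two_neighbors {p q : LShape} (h : p.Same q ∨ p.MeetH q) (w : ℕ × ℕ) :
    ∃ c d, ∀ a, (p.Edge w a ∨ q.Edge w a) → a = c ∨ a = d := by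
  obtain ⟨px, py, ph, pk, p1, p2⟩ := p
  obtain ⟨qx, qy, qh, qk, q1, q2⟩ := q
  obtain ⟨i, j⟩ := w
  simp only [Same, MeetH, Edge, UnitIn] at *
  by_cases hp : i = px ∧ j = py
  · refine ⟨(if px < ph then i + 1 else i - 1, j), (i, if py < pk then j + 1 else j - 1), ?_⟩
    rintro ⟨a, b⟩ hab
    simp only [Prod.mk.injEq]
    rcases h with h | h <;> rcases hab with (hab | hab) | (hab | hab) <;> split_ifs <;> omega
  by_cases hq : i = qx ∧ j = qy
  · refine ⟨(if qx < qh then i + 1 else i - 1, j), (i, if qy < qk then j + 1 else j - 1), ?_⟩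
    rintro ⟨a, b⟩ hab
    simp only [Prod.mk.injEq]
    rcases h with h | h <;> rcases hab with (hab | hab) | (hab | hab) <;> split_ifs <;> omega
  have hy : py = qy := by omega
  clear h
  by_cases hj : j = py
  · refine ⟨(i + 1, j), (i - 1, j), ?_⟩
    rintro ⟨a, b⟩ hab
    simp only [Prod.mk.injEq]
    rcases hab with (hab | hab) | (hab | hab) <;> omega
  · refine ⟨(i, j + 1), (i, j - 1), ?_⟩
    rintro ⟨a, b⟩ hab
    simp only [Prod.mk.injEq]
    rcases hab with (hab | hab) | (hab | hab) <;> omega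

theorem exists_common_edge {p q : LShape} (h : p.Same q ∨ p.MeetH q) :
    ∃ a b, p.Edge a b ∧ q.Edge a b := by
  obtain ⟨px, py, ph, pk, p1, p2⟩ := p
  obtain ⟨qx, qy, qh, qk, q1, q2⟩ := q
  simp only [Same, MeetH, Edge, UnitIn] at *
  rcases h with h | h
  · by_cases hlt : px < ph
    · exact ⟨(px, py), (px + 1, py), by dsimp only; omega, by dsimp only; omega⟩
    · exact ⟨(px - 1, py), (px, py), by dsimp only; omega, by dsimp only; omega⟩
  · exact ⟨(qh, py), (qh + 1, py), by dsimp only; omega, by dsimp only; omega⟩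

theorem edgeNonSplitting_of_same_or_meetH {p q : LShape} (h : p.Same q ∨ p.MeetH q) :
    EdgeNonSplitting p.Edge q.Edge := by
  refine ⟨exists_common_edge h, fun w a b c ha hb hc hab hac hbc => ?_⟩
  obtain ⟨d, e, hde⟩ := exists_two_neighbors h w
  have := hde a ha
  have := hde b hb
  have := hde c hc
  grind

theorem edgeNonSplitting_of_compat {p q : LShape} (h : p.Compat q) :
    EdgeNonSplitting p.Edge q.Edge := by
  -- `MeetV p q` unfolds to `MeetH p.swap q.swap`, and `swap` is an involution.
  have hV : ∀ p q : LShape, p.MeetV q → EdgeNonSplitting p.Edge q.Edge := fun p q h =>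
    edgeNonSplitting_swap (p := p.swap) (q := q.swap) (edgeNonSplitting_of_same_or_meetH (Or.inr h))
  rcases h with h | h | h | h | h
  · exact edgeNonSplitting_of_same_or_meetH (Or.inl h)
  · exact edgeNonSplitting_of_same_or_meetH (Or.inr h)
  · exact (edgeNonSplitting_of_same_or_meetH (Or.inr h)).symm
  · exact hV _ _ h
  · exact (hV _ _ h).symm

/-- At the bend of `p`, a path that does not split from `p` leaves only along the arms of `p`. -/
theorem not_edge_at_bend {p : LShape} {F : ℕ × ℕ → ℕ × ℕ → Prop}
    (h : EdgeNonSplitting p.Edge F) :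
    (p.x < p.h → ¬ F (p.x, p.y) (p.x - 1, p.y)) ∧ (p.h < p.x → ¬ F (p.x, p.y) (p.x + 1, p.y)) ∧
    (p.y < p.k → ¬ F (p.x, p.y) (p.x, p.y - 1)) ∧ (p.k < p.y → ¬ F (p.x, p.y) (p.x, p.y + 1)) := by
  obtain ⟨-, h⟩ := h
  obtain ⟨x, y, a, b, p1, p2⟩ := p
  dsimp only at *
  have h1 : Edge ⟨x, y, a, b, p1, p2⟩ (x, y) (if x < a then x + 1 else x - 1, y) := by
    dsimp only [Edge, UnitIn]
    split_ifs <;> omega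
  have h2 : Edge ⟨x, y, a, b, p1, p2⟩ (x, y) (x, if y < b then y + 1 else y - 1) := by
    dsimp only [Edge, UnitIn]
    split_ifs <;> omega
  refine ⟨fun hlt hF => ?_, fun hlt hF => ?_, fun hlt hF => ?_, fun hlt hF => ?_⟩ <;>
  · refine h _ _ _ _ (Or.inl h1) (Or.inl h2) (Or.inr hF) ?_ ?_ ?_ <;>
    · simp only [ne_eq, Prod.mk.injEq]
      split_ifs <;> omega

/-- If the left arm pointed left, a common edge would force the right arm to run through `x` and
split there; symmetrically at `x'`. So the arms face each other, and the same conditions stop each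
arm at the other bend. -/
theorem meet_of_unitIn {x h x' h' i j : ℕ} (hx : x < x')
    (hi : UnitIn x h i j) (hi' : UnitIn x' h' i j)
    (hl : x < h → ¬ UnitIn x' h' x (x - 1)) (hr : h < x → ¬ UnitIn x' h' x (x + 1))
    (hl' : x' < h' → ¬ UnitIn x h x' (x' - 1)) (hr' : h' < x' → ¬ UnitIn x h x' (x' + 1)) :
    h ≤ x' ∧ x ≤ h' ∧ h' < h := by
  simp only [UnitIn, true_and] at *
  have hh : x < h := by
    by_contra hh
    have := hr (by omega)
    clear hl hr hl' hr'
    omega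
  have hh' : h' < x' := by
    by_contra hh'
    have := hl' (by omega)
    clear hl hr hl' hr'
    omega
  replace hl := hl hh
  replace hr' := hr' hh'
  clear hr hl'
  omega

theorem lt_iff_of_unitIn {x h h' i j : ℕ}
    (hi : UnitIn x h i j) (hi' : UnitIn x h' i j) : x < h ↔ x < h' := by
  simp only [UnitIn] at *
  omega

theorem lt_iff_of_not_unitIn {x h h' : ℕ} (h1 : h ≠ x) (h2 : h' ≠ x)
    (hl : x < h → ¬ UnitIn x h' x (x - 1)) (hr : h < x → ¬ UnitIn x h' x (x + 1)) :
    x < h ↔ x < h' := by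
  simp only [UnitIn, true_and] at *
  omega

theorem compat_of_common_horizontal_edge {p q : LShape} (h : EdgeNonSplitting p.Edge q.Edge)
    {a b : ℕ × ℕ} (hab : a.2 = b.2) (ha : p.Edge a b) (hb : q.Edge a b) : p.Compat q := by
  have hp := not_edge_at_bend h
  have hq := not_edge_at_bend h.symm
  clear h
  obtain ⟨px, py, ph, pk, p1, p2⟩ := p
  obtain ⟨qx, qy, qh, qk, q1, q2⟩ := q
  obtain ⟨a1, a2⟩ := a
  obtain ⟨b1, b2⟩ := b
  dsimp only [Edge] at hab ha hb hp hq p1 q1 p2 q2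
  subst hab
  replace ha : a2 = py ∧ UnitIn px ph a1 b1 := by
    rcases ha with ha | ha
    · exact ha.2
    · simp only [UnitIn] at ha
      omega
  replace hb : a2 = qy ∧ UnitIn qx qh a1 b1 := by
    rcases hb with hb | hb
    · exact hb.2
    · simp only [UnitIn] at hb
      omega
  obtain ⟨rfl, ha⟩ := ha
  obtain ⟨rfl, hb⟩ := hb
  simp only [true_and, not_or] at hp hq
  -- Distinct bends on the common row give facing arms. Equal bends give equal quadrants: the shared
  -- edge fixes the horizontal direction, the absence of a split the vertical one.
  rcases lt_trichotomy px qx with hx | rfl | hx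
  · exact Or.inr (Or.inl ⟨rfl, meet_of_unitIn hx ha hb (fun h => (hp.1 h).1)
      (fun h => (hp.2.1 h).1) (fun h => (hq.1 h).1) (fun h => (hq.2.1 h).1)⟩)
  · simp only [true_and] at hp
    exact Or.inl ⟨rfl, rfl, lt_iff_of_unitIn ha hb, lt_iff_of_not_unitIn p2 q2
      (fun h => (hp.2.2.1 h).2) (fun h => (hp.2.2.2 h).2)⟩
  · exact Or.inr (Or.inr (Or.inl ⟨rfl, meet_of_unitIn hx hb ha (fun h => (hq.1 h).1)
      (fun h => (hq.2.1 h).1) (fun h => (hp.1 h).1) (fun h => (hp.2.1 h).1)⟩))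

theorem compat_of_edgeNonSplitting {p q : LShape} (h : EdgeNonSplitting p.Edge q.Edge) :
    p.Compat q := by
  obtain ⟨a, b, ha, hb⟩ := h.1
  by_cases hab : a.2 = b.2
  · exact compat_of_common_horizontal_edge h hab ha hb
  · refine compat_swap (p := p.swap) (q := q.swap) (compat_of_common_horizontal_edge
      (edgeNonSplitting_swap h) (a := a.swap) (b := b.swap) ?_
      (by simpa [swap_edge] using ha) (by simpa [swap_edge] using hb))
    simp only [Edge] at ha
    simp only [Prod.snd_swap]
    omega

/-! ### L-shapes and the triangular prism -/

/-- Three arms on one line cannot pairwise point in opposite directions. In the mixed case, two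
meetings of one kind put all bends on one line, while the third needs distinct positions across it.
-/
theorem exists_same_of_pairwise {p q r : LShape} (h1 : p.Compat q) (h2 : p.Compat r)
    (h3 : q.Compat r) : p.Same q ∨ p.Same r ∨ q.Same r := by
  by_contra! h
  obtain ⟨px, py, ph, pk, p1, p2⟩ := p
  obtain ⟨qx, qy, qh, qk, q1, q2⟩ := q
  obtain ⟨rx, ry, rh, rk, r1, r2⟩ := r
  simp only [Compat, h, false_or] at h1 h2 h3
  clear h
  simp only [MeetH, MeetV] at *
  omega

theorem Compat.meetH_of_same {p p' q q' : LShape} (hp : p.Same p') (hq : q.Same q')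
    (h : p.MeetH q) (h' : p'.Compat q') : p'.MeetH q' := by
  rcases h' with h' | h' | h' | h' | h'
  · simp only [Same, MeetH] at *; omega
  · exact h'
  all_goals simp only [Same, MeetH, MeetV] at *; omega

/-- The arm ends would satisfy the cycle `p.h ≤ q'.h < p'.h ≤ q.h < p.h`: the strict inequalities
come from the overlaps, the weak ones from the non-adjacencies. -/
theorem not_matching_of_meetH {p p' q q' : LShape} (hp : p.Same p') (hq : q.Same q')
    (h : p.MeetH q) (h' : p'.Compat q') (n : ¬ p.MeetH q') (n' : ¬ p'.MeetH q) : False := by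
  have h'' := h'.meetH_of_same hp hq h
  clear h'
  simp only [MeetH, Same] at *
  omega

/-- Two pairs of `L`-shapes with common corners do not induce a `2K₂`. -/
theorem not_matching {p p' q q' : LShape} (hp : p.Same p') (hq : q.Same q')
    (h : p.Compat q) (h' : p'.Compat q') (n : ¬ p.Compat q') (n' : ¬ p'.Compat q) : False := by
  have hV : ∀ {p p' q q' : LShape}, p.Same p' → q.Same q' → p.MeetV q → p'.Compat q' →
      ¬ p.Compat q' → ¬ p'.Compat q → False := by
    intro p p' q q' hp hq h h' n n'
    refine not_matching_of_meetH (p := p.swap) (p' := p'.swap) (q := q.swap) (q' := q'.swap)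
      hp.swap hq.swap h (compat_swap h') (fun h => n ?_) (fun h => n' ?_)
    · exact Or.inr (Or.inr (Or.inr (Or.inl h)))
    · exact Or.inr (Or.inr (Or.inr (Or.inl h)))
  rcases h with h | h | h | h | h
  · exact n (h.trans hq).compat
  · exact not_matching_of_meetH hp hq h h' (fun h => n (Or.inr (Or.inl h)))
      (fun h => n' (Or.inr (Or.inl h)))
  · exact not_matching_of_meetH hq hp h h'.symm (fun h => n' (Or.inr (Or.inr (Or.inl h))))
      (fun h => n (Or.inr (Or.inr (Or.inl h))))
  · exact hV hp hq h h' n n'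
  · exact hV hq hp h h'.symm (fun h => n' h.symm) (fun h => n h.symm)

/-- The obstruction to three pairwise facing L-shapes uses only bends and quadrants, not arm
lengths, so `p` and `p'` act as one corner. -/
theorem Compat.same_of_triangle {p p' q r : LShape} (hp : p.Same p') (h : p.Compat q)
    (h' : p'.Compat r) (hqr : q.Compat r) : p.Same q ∨ p'.Same r ∨ q.Same r := by
  by_contra! hn
  obtain ⟨n1, n2, n3⟩ := hn
  simp only [Compat, n1, n2, n3, false_or] at h h' hqr
  clear n1 n2 n3
  simp only [MeetH, MeetV, Same] at *
  omega

/-- `L`-shapes do not represent the triangular prism. -/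
theorem not_prism (p q : Fin 3 → LShape) (hp : ∀ i j, i ≠ j → (p i).Compat (p j))
    (hq : ∀ i j, i ≠ j → (q i).Compat (q j)) (hpq : ∀ i j, (p i).Compat (q j) ↔ i = j) :
    False := by
  have pair : ∀ f : Fin 3 → LShape, (∀ i j, i ≠ j → (f i).Compat (f j)) →
      ∃ i j, i ≠ j ∧ (f i).Same (f j) := by
    intro f hf
    rcases exists_same_of_pairwise (hf 0 1 (by decide)) (hf 0 2 (by decide)) (hf 1 2 (by decide))
      with h | h | h
    · exact ⟨0, 1, by decide, h⟩
    · exact ⟨0, 2, by decide, h⟩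
    · exact ⟨1, 2, by decide, h⟩
  have no_common : ∀ i j, i ≠ j → (p i).Same (p j) → (q i).Same (q j) → False :=
    fun i j hij h h' => not_matching h h' ((hpq i i).2 rfl) ((hpq j j).2 rfl)
      (fun h => hij ((hpq i j).1 h)) (fun h => hij ((hpq j i).1 h).symm)
  -- The triangle is the common corner of `p i`, `p j` together with `q i`, `q j`. A corner shared
  -- by `p` and `q` would make `p j`, `q i` or `p i`, `q j` adjacent.
  have no_share : ∀ i j k, i ≠ j → i ≠ k → j ≠ k → (p i).Same (p j) → (q i).Same (q k) →
      False := by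
    intro i j k hij hik hjk h h'
    rcases Compat.same_of_triangle h ((hpq i i).2 rfl) ((hpq j j).2 rfl) (hq i j hij)
      with h1 | h1 | h1
    · exact hij ((hpq j i).1 (h.symm.trans h1).compat).symm
    · exact hij ((hpq i j).1 (h.trans h1).compat)
    · exact no_common i j hij h h1
  obtain ⟨i, j, hij, h⟩ := pair p hp
  obtain ⟨k, l, hkl, h'⟩ := pair q hq
  by_cases h1 : i = k
  · subst h1
    by_cases h2 : j = l
    · subst h2
      exact no_common i j hij h h'
    · exact no_share i j l hij hkl h2 h h'
  by_cases h2 : i = l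
  · subst h2
    by_cases h3 : j = k
    · subst h3
      exact no_common i j hij h h'.symm
    · exact no_share i j k hij h1 h3 h h'.symm
  by_cases h3 : j = k
  · subst h3
    exact no_share j i l hij.symm hkl h2 h.symm h'
  · obtain rfl : j = l := by omega
    exact no_share j i k hij.symm h3 h1 h.symm h'.symm

end LShape

/-! ### Transfer between grid paths and natural coordinates -/

theorem GPath.nonSplitting_iff {m n : ℕ} (P Q : GPath (gridGraph m n)) :
    P.NonSplitting Q ↔ EdgeNonSplitting P.NatEdge Q.NatEdge := by
  have hinj : ∀ u v : Fin m × Fin n,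
      ((u.1 : ℕ), (u.2 : ℕ)) = ((v.1 : ℕ), (v.2 : ℕ)) ↔ u = v := by
    simp [Prod.ext_iff, Fin.ext_iff]
  have hP : ∀ (P : GPath (gridGraph m n)) (u v : Fin m × Fin n),
      P.NatEdge (u.1, u.2) (v.1, v.2) ↔ s(u, v) ∈ P.walk.edges := by
    intro P u v
    simp only [NatEdge, hinj]
    exact ⟨by rintro ⟨_, _, h, rfl, rfl⟩; exact h, fun h => ⟨u, v, h, rfl, rfl⟩⟩
  have hnb : ∀ w v : Fin m × Fin n, v ∈ (P.union Q).neighborSet w ↔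
      (s(w, v) ∈ P.walk.edges ∨ s(w, v) ∈ Q.walk.edges) := by
    intro w v
    simp only [union, Subgraph.mem_neighborSet, Subgraph.sup_adj, Walk.adj_toSubgraph_iff_mem_edges]
  have hsplit : P.splits Q = ∅ ↔ ∀ w a b c : Fin m × Fin n,
      a ∈ (P.union Q).neighborSet w → b ∈ (P.union Q).neighborSet w →
      c ∈ (P.union Q).neighborSet w → a ≠ b → a ≠ c → b ≠ c → False := by
    simp only [Set.eq_empty_iff_forall_notMem, splits, Set.mem_ofPred_eq]
    refine forall_congr' fun w => ?_
    rw [three_le_encard_iff]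
    constructor
    · exact fun h a b c ha hb hc hab hac hbc => h ⟨a, b, c, ha, hb, hc, hab, hac, hbc⟩
    · rintro h ⟨a, b, c, ha, hb, hc, hab, hac, hbc⟩
      exact h a b c ha hb hc hab hac hbc
  rw [NonSplitting, hsplit, EdgeNonSplitting]
  simp only [hnb]
  refine and_congr ⟨?_, ?_⟩ ⟨?_, ?_⟩
  · rintro ⟨e, h, h'⟩
    induction e with
    | _ u v => exact ⟨_, _, (hP P u v).2 h, (hP Q u v).2 h'⟩
  · rintro ⟨_, _, ⟨u, v, h, rfl, rfl⟩, h'⟩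
    exact ⟨_, h, (hP Q u v).1 h'⟩
  · intro h w a b c ha hb hc hab hac hbc
    have ex : ∀ a, P.NatEdge w a ∨ Q.NatEdge w a → ∃ w' a' : Fin m × Fin n,
        ((w'.1 : ℕ), (w'.2 : ℕ)) = w ∧ ((a'.1 : ℕ), (a'.2 : ℕ)) = a := by
      rintro a (⟨u, v, -, rfl, rfl⟩ | ⟨u, v, -, rfl, rfl⟩) <;> exact ⟨u, v, rfl, rfl⟩
    obtain ⟨w', a', rfl, rfl⟩ := ex a ha
    obtain ⟨-, b', -, rfl⟩ := ex b hb
    obtain ⟨-, c', -, rfl⟩ := ex c hc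
    simp only [hP, ne_eq, hinj] at *
    exact h w' a' b' c' ha hb hc hab hac hbc
  · intro h w a b c ha hb hc hab hac hbc
    simp only [← hP] at ha hb hc
    exact h _ _ _ _ ha hb hc (by simpa only [ne_eq, hinj]) (by simpa only [ne_eq, hinj])
      (by simpa only [ne_eq, hinj])

/-! ### Reduction to the prism -/

/-- The triangular prism, the complement of the cycle on six vertices. -/
def prism : SimpleGraph (Fin 3 × Fin 2) where
  Adj p q := p ≠ q ∧ (p.2 = q.2 ∨ p.1 = q.1)
  symm := ⟨fun _ _ h => ⟨h.1.symm, h.2.imp Eq.symm Eq.symm⟩⟩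
  loopless := ⟨fun _ h => h.1 rfl⟩

theorem enpGraph_comp {V V' W : Type*} {H : SimpleGraph W} (P : V → GPath H) {f : V' → V}
    (hf : Function.Injective f) : enpGraph (P ∘ f) = (enpGraph P).comap f := by
  ext u v
  simp [enpGraph, hf.eq_iff]

theorem exists_prism_equiv {V : Type*} {G : SimpleGraph V} {K K' : Set V}
    (h : IsCobipartition G K K') (e : G.between K K' ≃g threeK2) :
    ∃ f : V ≃ Fin 3 × Fin 2, G = prism.comap f := by
  classical
  obtain ⟨hd, hu, hK, hK'⟩ := h
  have hK'mem : ∀ v, v ∈ K' ↔ v ∉ K := fun v =>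
    ⟨fun h h' => Set.disjoint_left.1 hd h' h, fun h => by
      have : v ∈ K ∪ K' := hu ▸ Set.mem_univ v
      exact this.resolve_left h⟩
  have hadj : ∀ u v, (G.between K K').Adj u v ↔ ((e u).1 = (e v).1 ∧ (e u).2 ≠ (e v).2) :=
    fun u v => e.map_adj_iff.symm
  have hadj' : ∀ u v, (G.between K K').Adj u v ↔ G.Adj u v ∧ ¬(u ∈ K ↔ v ∈ K) := by
    intro u v
    rw [between_adj, hK'mem, hK'mem]
    tauto
  -- The isomorphism `e` may flip individual matching edges, so only its index of the edge is kept;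
  -- the side is read off from `K`.
  let f : V → Fin 3 × Fin 2 := fun v => ((e v).1, if v ∈ K then 0 else 1)
  have hf2 : ∀ u v, (f u).2 = (f v).2 ↔ (u ∈ K ↔ v ∈ K) := by
    intro u v
    by_cases h1 : u ∈ K <;> by_cases h2 : v ∈ K <;> simp [f, h1, h2]
  have hinj : Function.Injective f := by
    intro u v huv
    by_contra hne
    have h1 : (e u).1 = (e v).1 := (Prod.ext_iff.1 huv).1
    have h2 := (hf2 u v).1 (Prod.ext_iff.1 huv).2
    have h3 : (e u).2 ≠ (e v).2 := fun h => hne (e.injective (Prod.ext h1 h))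
    exact ((hadj' u v).1 ((hadj u v).2 ⟨h1, h3⟩)).2 h2
  have hbij : Function.Bijective f := by
    have : Finite V := Finite.of_equiv _ e.toEquiv.symm
    have h1 : Function.Injective (f ∘ e.symm) := hinj.comp e.symm.injective
    have h2 := (Finite.injective_iff_surjective.1 h1)
    exact ⟨hinj, Function.Surjective.of_comp h2⟩
  refine ⟨Equiv.ofBijective f hbij, ?_⟩
  ext u v
  simp only [comap_adj, Equiv.ofBijective_apply, prism, hf2, hinj.ne_iff]
  by_cases huv : u = v
  · simp [huv]
  by_cases hs : u ∈ K ↔ v ∈ K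
  · simp only [huv, hs, ne_eq, not_false_eq_true, true_or, and_self, iff_true]
    by_cases hu : u ∈ K
    · exact hK hu (hs.1 hu) huv
    · exact hK' ((hK'mem u).2 hu) ((hK'mem v).2 (fun h => hu (hs.2 h))) huv
  · have h1 := hadj u v
    rw [hadj'] at h1
    simp only [hs, not_false_eq_true, and_true] at h1
    simp only [h1, huv, hs, ne_eq, not_false_eq_true, true_and, false_or, f]
    exact and_iff_left_of_imp fun h h' => huv (e.injective (Prod.ext h h'))

/-! ### An explicit representation -/

/-- A finite form of the relation that can be evaluated by `decide`. -/
theorem GPath.nonSplitting_iff_card {m n : ℕ} (P Q : GPath (gridGraph m n)) :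
    P.NonSplitting Q ↔ (∃ e ∈ P.walk.edges, e ∈ Q.walk.edges) ∧
      ∀ w, (Finset.univ.filter fun v => s(w, v) ∈ P.walk.edges ∨ s(w, v) ∈ Q.walk.edges).card
        < 3 := by
  simp only [NonSplitting, EdgeIntersect, splits, Set.eq_empty_iff_forall_notMem,
    Set.mem_ofPred_eq, not_le]
  refine and_congr Iff.rfl (forall_congr' fun w => ?_)
  have : (P.union Q).neighborSet w = ((Finset.univ.filter fun v =>
      s(w, v) ∈ P.walk.edges ∨ s(w, v) ∈ Q.walk.edges : Finset _) : Set _) := by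
    ext v
    simp only [union, Subgraph.mem_neighborSet, Subgraph.sup_adj,
      Walk.adj_toSubgraph_iff_mem_edges, Finset.coe_filter, Finset.mem_univ, true_and,
      Set.mem_ofPred_eq]
  rw [this, Set.encard_coe_eq_coe_finsetCard]
  norm_cast

theorem GPath.numBends_eq_card {m n : ℕ} (P : GPath (gridGraph m n)) :
    P.numBends = (Finset.univ.filter fun w => w ∈ P.walk.support ∧ w ≠ P.src ∧ w ≠ P.tgt ∧
      (∃ a, s(w, a) ∈ P.walk.edges ∧ a.2 = w.2) ∧
      (∃ b, s(w, b) ∈ P.walk.edges ∧ b.1 = w.1)).card := by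
  rw [numBends, ← Set.ncard_coe_finset]
  congr 1
  ext w
  simp [bends]

/-- The walk `u, v, …` in a grid, from a walk that starts at `v`. -/
def gridCons {m n : ℕ} {u w : Fin m × Fin n} (v : Fin m × Fin n)
    (h : (u.2 = v.2 ∧ (u.1.val + 1 = v.1.val ∨ v.1.val + 1 = u.1.val)) ∨
      (u.1 = v.1 ∧ (u.2.val + 1 = v.2.val ∨ v.2.val + 1 = u.2.val)))
    (p : (gridGraph m n).Walk v w) : (gridGraph m n).Walk u w :=
  .cons (gridGraph_adj_iff.2 h) p

/-- A representation of the prism by paths with at most one bend. -/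
def prismRep : Fin 3 × Fin 2 → GPath (gridGraph 2 6)
  | (0, 0) => ⟨(0, 0), (0, 3),
    gridCons (0, 1) (by decide) <| gridCons (0, 2) (by decide) <| gridCons (0, 3) (by decide) Walk.nil,
    Walk.IsPath.mk' (by decide)⟩
  | (0, 1) => ⟨(1, 4), (0, 2),
    gridCons (0, 4) (by decide) <| gridCons (0, 3) (by decide) <| gridCons (0, 2) (by decide) Walk.nil,
    Walk.IsPath.mk' (by decide)⟩
  | (1, 0) => ⟨(0, 0), (0, 5),
    gridCons (0, 1) (by decide) <| gridCons (0, 2) (by decide) <| gridCons (0, 3) (by decide) <|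
    gridCons (0, 4) (by decide) <|
    gridCons (0, 5) (by decide) Walk.nil,
    Walk.IsPath.mk' (by decide)⟩
  | (1, 1) => ⟨(0, 3), (0, 4),
    gridCons (0, 4) (by decide) Walk.nil,
    Walk.IsPath.mk' (by decide)⟩
  | (2, 0) => ⟨(0, 1), (0, 2),
    gridCons (0, 2) (by decide) Walk.nil,
    Walk.IsPath.mk' (by decide)⟩
  | (2, 1) => ⟨(1, 1), (0, 4),
    gridCons (0, 1) (by decide) <| gridCons (0, 2) (by decide) <| gridCons (0, 3) (by decide) <|
    gridCons (0, 4) (by decide) Walk.nil,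
    Walk.IsPath.mk' (by decide)⟩

/-- All six paths run along the line with first coordinate `0`; only `(0, 1)` and `(2, 1)` leave it,
by hooks at positions `4` and `1`. Each non-adjacent pair either has no common edge or has a hook at
an interior vertex of the other path, which is a split. -/
theorem prismRep_isBendENPGRep : IsBendENPGRep 1 prism prismRep := by
  constructor
  · ext u v
    simp only [enpGraph, prism, GPath.nonSplitting_iff_card]
    revert u v
    decide +kernel
  · simp only [GPath.numBends_eq_card]
    decide +kernel

/-! ### The main theorem -/

theorem not_prism_of_one_bend {m n : ℕ} (P : Fin 3 × Fin 2 → GPath (gridGraph m n))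
    (hP : enpGraph P = prism) (h : ∀ v, (P v).numBends = 1) : False := by
  choose L hL using fun v => (P v).exists_lShape (h v)
  have hadj : ∀ u v, u ≠ v → ((L u).Compat (L v) ↔ prism.Adj u v) := by
    intro u v huv
    have hE : ∀ v, (P v).NatEdge = (L v).Edge := fun v => by
      ext a b
      exact hL v a b
    rw [← hP]
    simp only [enpGraph, huv, ne_eq, not_false_eq_true, true_and, GPath.nonSplitting_iff, hE]
    exact ⟨LShape.edgeNonSplitting_of_compat, LShape.compat_of_edgeNonSplitting⟩
  refine LShape.not_prism (fun i => L (i, 0)) (fun i => L (i, 1)) (fun i j hij => ?_)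
    (fun i j hij => ?_) (fun i j => ?_)
  · rw [hadj _ _ (by simpa using hij)]
    simpa [prism] using hij
  · rw [hadj _ _ (by simpa using hij)]
    simpa [prism] using hij
  · rw [hadj _ _ (by simp)]
    simp [prism]

theorem mainTheorem8 :
    (∀ (V : Type*) (G : SimpleGraph V) (K K' : Set V),
      IsCobipartition G K K' → Nonempty (G.between K K' ≃g threeK2) →
        IsBendENPG 1 G ∧
        ∀ (m n : ℕ) (P : V → GPath (gridGraph m n)),
          IsBendENPGRep 1 G P → ∃ v, (P v).numBends = 0) ∧
    (∃ (V : Type) (_ : Finite V) (G : SimpleGraph V),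
      IsBendENPG 1 G ∧
      ¬ ∃ (m n : ℕ) (P : V → GPath (gridGraph m n)),
        enpGraph P = G ∧ ∀ v, (P v).numBends = 1) := by
  refine ⟨fun V G K K' hG ⟨e⟩ => ?_, Fin 3 × Fin 2, inferInstance, prism,
    ⟨2, 6, prismRep, prismRep_isBendENPGRep⟩,
    fun ⟨m, n, P, hP, h⟩ => not_prism_of_one_bend P hP h⟩
  obtain ⟨f, rfl⟩ := exists_prism_equiv hG e
  refine ⟨⟨2, 6, prismRep ∘ f, ?_, fun v => prismRep_isBendENPGRep.2 (f v)⟩, ?_⟩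
  · rw [enpGraph_comp _ f.injective, prismRep_isBendENPGRep.1]
  · rintro m n P ⟨hP, hb⟩
    -- With at most one bend each and none straight, all paths have exactly one bend; relabelling by
    -- `f.symm` represents the prism itself.
    by_contra! h0
    refine not_prism_of_one_bend (P ∘ f.symm) ?_ fun v => ?_
    · rw [enpGraph_comp _ f.symm.injective, hP, comap_comap]
      ext u v
      simp
    · have h1 := hb (f.symm v)
      have h2 := h0 (f.symm v)
      simp only [Function.comp_apply]
      omega
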